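/- Let $\mathcal C\subset\mathbb R^n$ be a non-empty bounded open convex set with its Hilbert distance $d_{\mathcal C}(p,q)=\frac12\ln\left(\frac{\|q-a\|}{\|p-a\|}\cdot\frac{\|p-b\|}{\|q-b\|}\right)$ for $p\ne q$, where the line through $p,q$ meets $\partial\mathcal C$ at $a,b$ and the points occur in the order $a,p,q,b$, and $d_{\mathcal C}(p,p)=0$. Let $B(x,r)$ denote the open $d_{\mathcal C}$-ball. For $p\in\mathcal C$ and $v\neq0$ put $F_{\mathcal C}(p,v)=\frac12\|v\|\left(\frac1{\|p-p^-\|}+\frac1{\|p-p^+\|}\right)$, where $p^\pm$ are the points at which the half-lines from $p$ in the directions $\pm v$ meet $\partial\mathcal C$, and $F_{\mathcal C}(p,0)=0$. Let $\mu_{\mathcal C}$ be the Hilbert measure on $\mathcal C$, which has density $p\mapsto\omega_n/\mathrm{Vol}\{v\in\mathbb R^n: F_{\mathcal C}(p,v)<1\}$ with respect to Lebesgue measure $\mathrm{Vol}$, where $\omega_n$ is the volume of the Euclidean unit ball. Let $\mathbf G$ be a discretisation of $\mathcal C$: its vertex set is a subset $\mathcal G\subset\mathcal C$ such that, for some $\varepsilon,\rho>0$,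 any two distinct points of $\mathcal G$ are at distance $d_{\mathcal C}\ge\varepsilon$ and $\mathcal C=\bigcup_{\xi\in\mathcal G}B(\xi,\rho)$; the neighbours of $\xi\in\mathcal G$ are the points of $(\mathcal G\cap B(\xi,3\rho))\setminus\{\xi\}$. Let $d_{\mathbf G}$ be the combinatorial distance of $\mathbf G$. For $R\ge 1$ write $V_{\mathbf G}(\xi,R)=\mathrm{card}\{\eta\in\mathcal G: d_{\mathbf G}(\xi,\eta)\le R\}$ for $\xi\in\mathcal G$, and $V_{\mathcal C}(x,R)=\mu_{\mathcal C}(B(x,R))$ for $x\in\mathcal C$. Say that $\mathbf G$ (respectively $\mathcal C$) has *polynomial volume growth* if there are a constant $a$ and an integer $d\ge0$ such that the volume function $V=V_{\mathbf G}$ (respectively $V=V_{\mathcal C}$) satisfies $V(x,R)\le aR^d$ for all centres $x$ and all $R\ge1$, and *exponential volume growth* if there are $a,c>0$ such that $V(x,R)\ge a e^{cR}$ for all centres $x$ and all $R\ge1$. Then: 1. $\mathbf G$ has polynomial volume growth if and only if $\mathcal C$ has polynomial volume growth; 2. $\mathbf G$ has exponential volume growth if and only if $\mathcal C$ has exponential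 volume growth. Both equivalences also hold for growth about fixed centres: for every $\xi\in\mathcal G$ and $x\in\mathcal C$, $V_{\mathbf G}(\xi,\cdot)$ satisfies such a polynomial upper bound (respectively exponential lower bound) for $R\ge1$, with constants that may depend on the centre, if and only if $V_{\mathcal C}(x,\cdot)$ does. -/

import Mathlib

open scoped ENNReal

noncomputable section

namespace HilbertGeometry

/-- `ℝⁿ` with its canonical Euclidean norm and Lebesgue measure. -/
abbrev E (n : ℕ) : Type := EuclideanSpace ℝ (Fin n)

/-- The sets carrying a Hilbert geometry: non-empty bounded open convex subsets of `ℝⁿ`. -/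
structure IsConvexDomain {n : ℕ} (C : Set (E n)) : Prop where
  isOpen : IsOpen C
  convex : Convex ℝ C
  nonempty : C.Nonempty
  isBounded : Bornology.IsBounded C

/-- The point at which the half-line from `p` in the direction `v` leaves `C`; for a convex
domain `C`, a point `p` of `C` and `v ≠ 0`, it is the unique point of that half-line on the
boundary of `C`. -/
def exitPoint {n : ℕ} (C : Set (E n)) (p v : E n) : E n :=
  p + sSup {t : ℝ | p + t • v ∈ C} • v

/-- The exit point lies on the boundary. -/
theorem exitPoint_mem_frontier {n : ℕ} {C : Set (E n)} (hC : IsConvexDomain C) {p v : E n}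
    (hp : p ∈ C) (hv : v ≠ 0) : exitPoint C p v ∈ frontier C := by
  set f : ℝ → E n := fun t => p + t • v with hf
  have hfc : Continuous f := by fun_prop
  set T : Set ℝ := {t : ℝ | p + t • v ∈ C} with hT
  have hTopen : IsOpen T := hC.isOpen.preimage hfc
  have hne : T.Nonempty := ⟨0, by simpa [hT] using hp⟩
  have hbdd : BddAbove T := by
    obtain ⟨M, hM⟩ := hC.isBounded.exists_norm_le
    refine ⟨(M + ‖p‖) / ‖v‖, fun t ht => ?_⟩
    rw [le_div_iff₀ (norm_pos_iff.mpr hv)]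
    have h1 : ‖p + t • v‖ ≤ M := hM _ ht
    have h2 : ‖t • v‖ ≤ ‖p + t • v‖ + ‖p‖ := by
      simpa using norm_sub_le (p + t • v) p
    rw [norm_smul, Real.norm_eq_abs] at h2
    nlinarith [le_abs_self t, norm_nonneg v]
  have hcl : sSup T ∈ closure T := csSup_mem_closure hne hbdd
  have hnot : sSup T ∉ T := fun h => by
    obtain ⟨δ, hδ, hball⟩ := Metric.isOpen_iff.mp hTopen _ h
    have : sSup T + δ / 2 ∈ T := hball (by simp [abs_of_pos hδ]; linarith)
    have := le_csSup hbdd this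
    linarith
  rw [hC.isOpen.frontier_eq]
  exact ⟨closure_mono (Set.image_preimage_subset f C)
    (image_closure_subset_closure_image hfc ⟨_, hcl, rfl⟩), hnot⟩

/-- The Hilbert distance `(1/2) ln [a, p, q, b]`, where the line through the distinct points
`p`, `q` meets the boundary at `a` and `b`, in the order `a`, `p`, `q`, `b`. -/
def hilbertDist {n : ℕ} (C : Set (E n)) (p q : E n) : ℝ :=
  open Classical in
  if p = q then 0 else
    let a := exitPoint C p (p - q)
    let b := exitPoint C q (q - p)
    1 / 2 * Real.log (‖q - a‖ / ‖p - a‖ * (‖p - b‖ / ‖q - b‖))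

theorem hilbertDist_comm {n : ℕ} (C : Set (E n)) (p q : E n) :
    hilbertDist C p q = hilbertDist C q p := by
  by_cases h : p = q
  · rw [h]
  · simp only [hilbertDist, h, Ne.symm h, if_false]
    rw [mul_comm (‖q - _‖ / _)]

/-- The open ball of centre `x` and radius `r` of the Hilbert geometry on `C`. -/
def hilbertBall {n : ℕ} (C : Set (E n)) (x : E n) (r : ℝ) : Set (E n) :=
  {y | y ∈ C ∧ hilbertDist C x y < r}

/-- The Finsler norm `F_C(p, v)`; it vanishes at `v = 0`. -/
def finslerNorm {n : ℕ} (C : Set (E n)) (p v : E n) : ℝ :=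
  1 / 2 * ‖v‖ * (1 / ‖p - exitPoint C p (-v)‖ + 1 / ‖p - exitPoint C p v‖)

/-- The density `h_C(p) = ω_n / Vol {v | F_C(p, v) < 1}` of the Hilbert measure. -/
def hilbertDensity {n : ℕ} (C : Set (E n)) (p : E n) : ℝ≥0∞ :=
  MeasureTheory.volume (Metric.ball (0 : E n) 1) /
    MeasureTheory.volume {v : E n | finslerNorm C p v < 1}

/-- The Hilbert measure of `C`. -/
def hilbertMeasure {n : ℕ} (C : Set (E n)) : MeasureTheory.Measure (E n) :=
  (MeasureTheory.volume.restrict C).withDensity (hilbertDensity C)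

/-- `𝒢` is the vertex set of a discretisation of the Hilbert geometry on `C`, with separation
`ε` and covering radius `ρ`. -/
structure IsDiscretisation {n : ℕ} (C 𝒢 : Set (E n)) (ε ρ : ℝ) : Prop where
  subset : 𝒢 ⊆ C
  ε_pos : 0 < ε
  ρ_pos : 0 < ρ
  separated : ∀ ξ ∈ 𝒢, ∀ η ∈ 𝒢, ξ ≠ η → ε ≤ hilbertDist C ξ η
  covering : C = ⋃ ξ ∈ 𝒢, hilbertBall C ξ ρ

/-- The graph of the discretisation: the neighbours of `ξ` are the points of `𝒢` other than `ξ`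
in the ball of centre `ξ` and radius `3ρ`. -/
def discretisationGraph {n : ℕ} (C 𝒢 : Set (E n)) (ρ : ℝ) : SimpleGraph 𝒢 where
  Adj ξ η := ξ ≠ η ∧ hilbertDist C ξ η < 3 * ρ
  symm := ⟨fun ξ η h => ⟨h.1.symm, by rw [hilbertDist_comm]; exact h.2⟩⟩
  loopless := ⟨fun _ h => h.1 rfl⟩

/-- The number of vertices at combinatorial distance at most `R` from `ξ` (the reachability
clause discards the value `0` given by `SimpleGraph.dist` to unconnected vertices). -/
def graphVolume {V : Type*} (G : SimpleGraph V) (ξ : V) (R : ℝ) : ℝ≥0∞ :=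
  (({η : V | G.Reachable ξ η ∧ (G.dist ξ η : ℝ) ≤ R}.encard : ℕ∞) : ℝ≥0∞)

/-- The Hilbert measure of the ball of radius `R` around a point `x` of `C`. -/
def hilbertVolume {n : ℕ} (C : Set (E n)) (x : C) (R : ℝ) : ℝ≥0∞ :=
  hilbertMeasure C (hilbertBall C x R)

/-- Polynomial volume growth around one centre: `v R ≤ a R ^ d` for all `R ≥ 1`. -/
def PolynomialGrowthAt (v : ℝ → ℝ≥0∞) : Prop :=
  ∃ (a : ℝ) (d : ℕ), ∀ R : ℝ, 1 ≤ R → v R ≤ ENNReal.ofReal (a * R ^ d)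

/-- Exponential volume growth around one centre: `a e ^ (c R) ≤ v R` for all `R ≥ 1`. -/
def ExponentialGrowthAt (v : ℝ → ℝ≥0∞) : Prop :=
  ∃ a c : ℝ, 0 < a ∧ 0 < c ∧ ∀ R : ℝ, 1 ≤ R → ENNReal.ofReal (a * Real.exp (c * R)) ≤ v R

/-- Polynomial volume growth, with constants that do not depend on the centre. -/
def PolynomialGrowth {X : Type*} (V : X → ℝ → ℝ≥0∞) : Prop :=
  ∃ (a : ℝ) (d : ℕ), ∀ (x : X) (R : ℝ), 1 ≤ R → V x R ≤ ENNReal.ofReal (a * R ^ d)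

/-- Exponential volume growth, with constants that do not depend on the centre. -/
def ExponentialGrowth {X : Type*} (V : X → ℝ → ℝ≥0∞) : Prop :=
  ∃ a c : ℝ, 0 < a ∧ 0 < c ∧
    ∀ (x : X) (R : ℝ), 1 ≤ R → ENNReal.ofReal (a * Real.exp (c * R)) ≤ V x R

end HilbertGeometry

end

/-!
The graph and the convex set have comparable volume functions: up to a multiplicative constant and
an affine change of the radius, each is bounded by the other, and such a comparison preserves both
growth types.

Everything is read off from the gauge `g_p` of `C - p` for `p ∈ C`. The Hilbert distance is the
symmetrisation `-(log A(p, q) + log A(q, p)) / 2` of the Funk distance, where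
`A(p, q) = 1 - g_p(q - p)` (`hilbertDist_eq`), and the Finsler norm is
`F(p, v) = (g_p(v) + g_p(-v)) / 2` (`finslerNorm_eq`). Convexity of `C` enters through two
inequalities: `A(p, q) A(q, z) ≤ A(p, z)`, which gives the triangle inequality
(`funkRatio_mul_le`), and `A(p, q) g_q ≤ g_p` (`gaugeAt_mul_le`). The latter says that Euclidean
segments are geodesics, and also that `F(q, ·) ≤ exp (2 r) F(p, ·)` as soon as `d(p, q) < r`.

Hence on a Hilbert ball of radius `r` about `x` the density of the Hilbert measure is comparable to
its value at `x`, while the ball itself lies between two multiples of the unit ball of `F(x, ·)`.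
By the scaling of Lebesgue measure, the measure of the ball is bounded above and below by positive
constants that depend on `n` and `r` only (`exists_hilbertMeasure_hilbertBall_le`,
`exists_le_hilbertMeasure_hilbertBall`); no compactness argument is needed.

On the side of the graph, adjacent vertices are at Hilbert distance less than `3 ρ`. Conversely,
following a geodesic in steps of length `ρ` and choosing a vertex within `ρ` of each step gives
`d_G ≤ d / ρ + 2` (`reachable_and_dist_le`). Packing by the disjoint balls of radius `ε / 2` and
covering by the balls of radius `ρ` then yield the two comparisons (`exists_graphVolume_le`,
`exists_hilbertVolume_le`). They are uniform in the two centres as long as these stay at bounded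
distance, so the uniform and the centred statements are both instances of `growth_iff`.
-/

noncomputable section

namespace HilbertGeometry

variable {n : ℕ} {C 𝒢 : Set (E n)} {p q x z v : E n} {r ε ρ : ℝ}

/-! ### The gauge of a convex domain seen from one of its points -/

/-- The gauge of `C` seen from `p`, that is the Minkowski functional of `C - p`; for `v ≠ 0` the
half-line from `p` in the direction `v` leaves `C` at time `(gaugeAt C p v)⁻¹`. -/
def gaugeAt (C : Set (E n)) (p v : E n) : ℝ :=
  gauge ((fun w => p + w) ⁻¹' C) v

theorem IsConvexDomain.isOpen_preimage_add (hC : IsConvexDomain C) (p : E n) :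
    IsOpen ((fun w => p + w) ⁻¹' C) :=
  hC.isOpen.preimage (by fun_prop)

theorem IsConvexDomain.preimage_add_mem_nhds (hC : IsConvexDomain C) (hp : p ∈ C) :
    (fun w => p + w) ⁻¹' C ∈ nhds (0 : E n) :=
  (hC.isOpen_preimage_add p).mem_nhds (by simpa using hp)

theorem IsConvexDomain.convex_preimage_add (hC : IsConvexDomain C) (p : E n) :
    Convex ℝ ((fun w => p + w) ⁻¹' C) :=
  hC.convex.translate_preimage_right p

theorem IsConvexDomain.isBounded_preimage_add (hC : IsConvexDomain C) (p : E n) :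
    Bornology.IsBounded ((fun w => p + w) ⁻¹' C) := by
  obtain ⟨M, hM⟩ := hC.isBounded.exists_norm_le
  refine isBounded_iff_forall_norm_le.mpr ⟨M + ‖p‖, fun w hw => ?_⟩
  have h1 := hM _ hw
  have h2 : ‖w‖ ≤ ‖p + w‖ + ‖p‖ := by simpa using norm_sub_le (p + w) p
  linarith

theorem gaugeAt_nonneg (C : Set (E n)) (p v : E n) : 0 ≤ gaugeAt C p v :=
  gauge_nonneg _

@[simp]
theorem gaugeAt_zero (C : Set (E n)) (p : E n) : gaugeAt C p 0 = 0 :=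
  gauge_zero

theorem gaugeAt_smul (C : Set (E n)) (p v : E n) {t : ℝ} (ht : 0 ≤ t) :
    gaugeAt C p (t • v) = t * gaugeAt C p v :=
  gauge_smul_of_nonneg ht v

theorem gaugeAt_add_le (hC : IsConvexDomain C) (hp : p ∈ C) (v w : E n) :
    gaugeAt C p (v + w) ≤ gaugeAt C p v + gaugeAt C p w :=
  gauge_add_le (hC.convex_preimage_add p) (absorbent_nhds_zero (hC.preimage_add_mem_nhds hp)) v w

theorem continuous_gaugeAt (hC : IsConvexDomain C) (hp : p ∈ C) : Continuous (gaugeAt C p) :=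
  continuous_gauge (hC.convex_preimage_add p) (hC.preimage_add_mem_nhds hp)

theorem gaugeAt_pos (hC : IsConvexDomain C) (hp : p ∈ C) (hv : v ≠ 0) : 0 < gaugeAt C p v :=
  (gauge_pos (absorbent_nhds_zero (hC.preimage_add_mem_nhds hp))
    ((NormedSpace.isVonNBounded_iff ℝ).mpr (hC.isBounded_preimage_add p))).mpr hv

theorem gaugeAt_lt_one_iff (hC : IsConvexDomain C) (hp : p ∈ C) :
    gaugeAt C p v < 1 ↔ p + v ∈ C :=
  Set.ext_iff.mp (setOfPred_gauge_lt_one_eq_self_of_isOpen (hC.convex_preimage_add p)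
    (mem_of_mem_nhds (hC.preimage_add_mem_nhds hp)) (hC.isOpen_preimage_add p)) v

theorem gaugeAt_sub_lt_one (hC : IsConvexDomain C) (hp : p ∈ C) (hq : q ∈ C) :
    gaugeAt C p (q - p) < 1 :=
  (gaugeAt_lt_one_iff hC hp).mpr (by simpa using hq)

theorem exitPoint_eq (hC : IsConvexDomain C) (hp : p ∈ C) (hv : v ≠ 0) :
    exitPoint C p v = p + (gaugeAt C p v)⁻¹ • v := by
  have hg := gaugeAt_pos hC hp hv
  have key : ∀ t : ℝ, 0 ≤ t → (p + t • v ∈ C ↔ t < (gaugeAt C p v)⁻¹) := fun t ht => by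
    rw [← gaugeAt_lt_one_iff hC hp, gaugeAt_smul _ _ _ ht, inv_eq_one_div, lt_div_iff₀ hg]
  have : sSup {t : ℝ | p + t • v ∈ C} = (gaugeAt C p v)⁻¹ := by
    refine IsLUB.csSup_eq ⟨fun t ht => ?_, fun b hb => ?_⟩ ⟨0, by simpa using hp⟩
    · rcases le_or_gt 0 t with h | h
      · exact ((key t h).mp ht).le
      · exact h.le.trans (inv_pos.mpr hg).le
    · refine le_of_forall_lt fun t ht => ?_
      obtain ⟨s, hs1, hs2⟩ := exists_between (max_lt ht (inv_pos.mpr hg))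
      have h0 : 0 ≤ s := (le_max_right _ _).trans hs1.le
      exact ((le_max_left _ _).trans_lt hs1).trans_le (hb ((key s h0).mpr hs2))
  rw [exitPoint, this]

/-- The gauges seen from two points of `C`: if `s = gaugeAt C p (q - p)`, then
`q + (1 - s) (C - p) ⊆ C` by convexity. -/
theorem gaugeAt_mul_le (hC : IsConvexDomain C) (hp : p ∈ C) (hq : q ∈ C) (v : E n) :
    gaugeAt C q v * (1 - gaugeAt C p (q - p)) ≤ gaugeAt C p v := by
  have hs := gaugeAt_sub_lt_one hC hp hq
  refine le_of_forall_gt fun l hl => ?_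
  have hl0 : 0 < l := (gaugeAt_nonneg C p v).trans_lt hl
  set s := gaugeAt C p (q - p) with hsdef
  have h0 : 0 ≤ (1 - s) / l := div_nonneg (by linarith) hl0.le
  have h1 : gaugeAt C p ((q - p) + ((1 - s) / l) • v) < 1 := by
    refine (gaugeAt_add_le hC hp _ _).trans_lt ?_
    rw [gaugeAt_smul _ _ _ h0, ← hsdef]
    have : (1 - s) / l * gaugeAt C p v < (1 - s) / l * l :=
      mul_lt_mul_of_pos_left hl (div_pos (by linarith) hl0)
    rw [div_mul_cancel₀ _ hl0.ne'] at this
    linarith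
  rw [gaugeAt_lt_one_iff hC hp, ← add_assoc, add_sub_cancel, ← gaugeAt_lt_one_iff hC hq,
    gaugeAt_smul _ _ _ h0, div_mul_eq_mul_div, div_lt_one hl0] at h1
  linarith

/-- Along a line, the exit times from `p` and from `q` differ by the time from `p` to `q`. -/
theorem one_add_gaugeAt_mul (hC : IsConvexDomain C) (hp : p ∈ C) (hq : q ∈ C) :
    (1 + gaugeAt C p (p - q)) * (1 - gaugeAt C q (p - q)) = 1 := by
  have hle := gaugeAt_mul_le hC hq hp (p - q)
  refine le_antisymm (by linarith) ?_
  rcases eq_or_ne p q with rfl | hpq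
  · simp
  have hb := gaugeAt_pos hC hq (sub_ne_zero.mpr hpq)
  have hb1 := gaugeAt_sub_lt_one hC hq hp
  set b := gaugeAt C q (p - q) with hb_def
  have ht : 0 ≤ b⁻¹ - 1 := sub_nonneg.mpr ((one_le_inv₀ hb).mpr hb1.le)
  -- the exit point from `q` in the direction `p - q` is not in `C`
  have h1 : ¬ gaugeAt C p ((b⁻¹ - 1) • (p - q)) < 1 := by
    have e : p + (b⁻¹ - 1) • (p - q) = q + b⁻¹ • (p - q) := by module
    rw [gaugeAt_lt_one_iff hC hp, e, ← gaugeAt_lt_one_iff hC hq,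
      gaugeAt_smul _ _ _ (inv_nonneg.mpr hb.le), ← hb_def, inv_mul_cancel₀ hb.ne']
    exact lt_irrefl _
  rw [gaugeAt_smul _ _ _ ht, not_lt] at h1
  have h2 := mul_le_mul_of_nonneg_left h1 hb.le
  have h3 : b * ((b⁻¹ - 1) * gaugeAt C p (p - q)) = (1 - b) * gaugeAt C p (p - q) := by
    field_simp
  rw [h3] at h2
  linarith

/-! ### The Hilbert distance as a symmetrised Funk distance -/

/-- The Funk ratio `1 - g`, where `g` is the gauge of `C - p` at `q - p`; minus its logarithm is
the Funk distance from `p` to `q`, which is not symmetric. -/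
def funkRatio (C : Set (E n)) (p q : E n) : ℝ :=
  1 - gaugeAt C p (q - p)

theorem funkRatio_pos (hC : IsConvexDomain C) (hp : p ∈ C) (hq : q ∈ C) : 0 < funkRatio C p q :=
  sub_pos.mpr (gaugeAt_sub_lt_one hC hp hq)

theorem funkRatio_le_one (C : Set (E n)) (p q : E n) : funkRatio C p q ≤ 1 :=
  sub_le_self _ (gaugeAt_nonneg _ _ _)

@[simp]
theorem funkRatio_self (C : Set (E n)) (p : E n) : funkRatio C p p = 1 := by
  simp [funkRatio]

/-- The triangle inequality for the Funk distance. -/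
theorem funkRatio_mul_le (hC : IsConvexDomain C) (hp : p ∈ C) (hq : q ∈ C) (hz : z ∈ C) :
    funkRatio C p q * funkRatio C q z ≤ funkRatio C p z := by
  have hA := funkRatio_pos hC hp hq
  have hz1 := funkRatio_pos hC hp hz
  by_contra! hlt
  rw [← div_lt_iff₀' hA] at hlt
  obtain ⟨m, hm1, hm2⟩ := exists_between hlt
  have hm0 : 0 < m := (div_pos hz1 hA).trans hm1
  -- `z = m q + l (q + u)` with `m + l = 1` and `q + u ∈ C`
  have hl : gaugeAt C q (z - q) < 1 - m := by
    rw [funkRatio] at hm2; linarith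
  have hl0 : 0 < 1 - m := (gaugeAt_nonneg _ _ _).trans_lt hl
  have hu : q + (1 - m)⁻¹ • (z - q) ∈ C := by
    rw [← gaugeAt_lt_one_iff hC hq, gaugeAt_smul _ _ _ (inv_nonneg.mpr hl0.le),
      inv_mul_lt_one₀ hl0]
    exact hl
  have hu1 := gaugeAt_sub_lt_one hC hp hu
  have hdec : z - p = m • (q - p) + (1 - m) • (q + (1 - m)⁻¹ • (z - q) - p) := by
    rw [smul_sub (1 - m), smul_add (1 - m), smul_inv_smul₀ hl0.ne']
    module
  have h := gaugeAt_add_le hC hp (m • (q - p)) ((1 - m) • (q + (1 - m)⁻¹ • (z - q) - p))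
  rw [← hdec, gaugeAt_smul _ _ _ hm0.le, gaugeAt_smul _ _ _ hl0.le] at h
  rw [div_lt_iff₀' hA] at hm1
  have := mul_lt_mul_of_pos_left hu1 hl0
  unfold funkRatio at *
  nlinarith

/-- The Funk distance is additive along segments; together with `funkRatio_mul_le` the inequality
is an equality. -/
theorem funkRatio_le_mul_of_mem_segment (hC : IsConvexDomain C) (hp : p ∈ C) (hq : q ∈ C)
    {t : ℝ} (ht : t ∈ Set.Icc (0 : ℝ) 1) :
    funkRatio C p q ≤
      funkRatio C p (p + t • (q - p)) * funkRatio C (p + t • (q - p)) q := by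
  have hz : p + t • (q - p) ∈ C := hC.convex.add_smul_sub_mem hp hq ht
  have h := gaugeAt_mul_le hC hp hz (q - p)
  have e : q - (p + t • (q - p)) = (1 - t) • (q - p) := by module
  rw [add_sub_cancel_left, gaugeAt_smul _ _ _ ht.1] at h
  rw [funkRatio, funkRatio, funkRatio, e, add_sub_cancel_left, gaugeAt_smul _ _ _ ht.1,
    gaugeAt_smul _ _ _ (by linarith [ht.2])]
  nlinarith [mul_le_mul_of_nonneg_left h (show 0 ≤ 1 - t by linarith [ht.2])]

theorem hilbertDist_eq (hC : IsConvexDomain C) (hp : p ∈ C) (hq : q ∈ C) :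
    hilbertDist C p q = -(1 / 2) * (Real.log (funkRatio C p q) + Real.log (funkRatio C q p)) := by
  by_cases hpq : p = q
  · subst hpq
    simp [hilbertDist]
  have key : ∀ {p q : E n}, p ∈ C → q ∈ C → p ≠ q →
      ‖q - exitPoint C p (p - q)‖ / ‖p - exitPoint C p (p - q)‖ = (funkRatio C q p)⁻¹ := by
    intro p q hp hq hpq
    have hv := sub_ne_zero.mpr hpq
    have hg := gaugeAt_pos hC hp hv
    have e1 : q - exitPoint C p (p - q) = -((1 + (gaugeAt C p (p - q))⁻¹) • (p - q)) := by
      rw [exitPoint_eq hC hp hv]; module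
    have e2 : p - exitPoint C p (p - q) = -((gaugeAt C p (p - q))⁻¹ • (p - q)) := by
      rw [exitPoint_eq hC hp hv]; module
    have hn := norm_pos_iff.mpr hv
    rw [e1, e2, norm_neg, norm_neg, norm_smul, norm_smul, Real.norm_of_nonneg (by positivity),
      Real.norm_of_nonneg (by positivity), mul_div_mul_right _ _ hn.ne', eq_comm, funkRatio,
      inv_eq_iff_eq_inv]
    have := one_add_gaugeAt_mul hC hp hq
    rw [inv_div]
    field_simp
    nlinarith
  rw [hilbertDist, if_neg hpq]
  simp only
  rw [key hp hq hpq, key hq hp (Ne.symm hpq),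
    Real.log_mul (inv_pos.mpr (funkRatio_pos hC hq hp)).ne'
      (inv_pos.mpr (funkRatio_pos hC hp hq)).ne', Real.log_inv, Real.log_inv]
  ring

theorem hilbertDist_nonneg (hC : IsConvexDomain C) (hp : p ∈ C) (hq : q ∈ C) :
    0 ≤ hilbertDist C p q := by
  rw [hilbertDist_eq hC hp hq]
  linarith [Real.log_nonpos (funkRatio_pos hC hp hq).le (funkRatio_le_one C p q),
    Real.log_nonpos (funkRatio_pos hC hq hp).le (funkRatio_le_one C q p)]

theorem hilbertDist_triangle (hC : IsConvexDomain C) (hp : p ∈ C) (hq : q ∈ C) (hz : z ∈ C) :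
    hilbertDist C p z ≤ hilbertDist C p q + hilbertDist C q z := by
  rw [hilbertDist_eq hC hp hq, hilbertDist_eq hC hp hz, hilbertDist_eq hC hq hz]
  have h : ∀ {a b c : E n}, a ∈ C → b ∈ C → c ∈ C →
      Real.log (funkRatio C a b) + Real.log (funkRatio C b c) ≤ Real.log (funkRatio C a c) := by
    intro a b c ha hb hc
    have h1 := funkRatio_pos hC ha hb
    have h2 := funkRatio_pos hC hb hc
    rw [← Real.log_mul h1.ne' h2.ne']
    exact Real.log_le_log (mul_pos h1 h2) (funkRatio_mul_le hC ha hb hc)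
  linarith [h hp hq hz, h hz hq hp]

/-- The Hilbert distance is additive along segments. -/
theorem hilbertDist_add_le_of_mem_segment (hC : IsConvexDomain C) (hp : p ∈ C) (hq : q ∈ C)
    {t : ℝ} (ht : t ∈ Set.Icc (0 : ℝ) 1) :
    hilbertDist C p (p + t • (q - p)) + hilbertDist C (p + t • (q - p)) q ≤
      hilbertDist C p q := by
  have hz : p + t • (q - p) ∈ C := hC.convex.add_smul_sub_mem hp hq ht
  have h1 := funkRatio_le_mul_of_mem_segment hC hp hq ht
  have h2 := funkRatio_le_mul_of_mem_segment hC hq hp (t := 1 - t)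
    ⟨by linarith [ht.2], by linarith [ht.1]⟩
  have e : q + (1 - t) • (p - q) = p + t • (q - p) := by module
  rw [e] at h2
  rw [hilbertDist_eq hC hp hq, hilbertDist_eq hC hp hz, hilbertDist_eq hC hz hq]
  set z := p + t • (q - p)
  have h1' := Real.log_le_log (funkRatio_pos hC hp hq) h1
  have h2' := Real.log_le_log (funkRatio_pos hC hq hp) h2
  rw [Real.log_mul (funkRatio_pos hC hp hz).ne' (funkRatio_pos hC hz hq).ne'] at h1'
  rw [Real.log_mul (funkRatio_pos hC hq hz).ne' (funkRatio_pos hC hz hp).ne'] at h2'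
  linarith

theorem hilbertDist_lt_iff (hC : IsConvexDomain C) (hp : p ∈ C) (hq : q ∈ C) :
    hilbertDist C p q < r ↔ Real.exp (-(2 * r)) < funkRatio C p q * funkRatio C q p := by
  have h1 := funkRatio_pos hC hp hq
  have h2 := funkRatio_pos hC hq hp
  rw [hilbertDist_eq hC hp hq, ← Real.log_mul h1.ne' h2.ne',
    ← Real.lt_log_iff_exp_lt (mul_pos h1 h2)]
  constructor <;> intro h <;> linarith

/-- A description of the Hilbert ball in terms of the gauge seen from its centre only. -/
theorem hilbertDist_lt_iff_gaugeAt (hC : IsConvexDomain C) (hp : p ∈ C) (hq : q ∈ C) :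
    hilbertDist C p q < r ↔
      1 + gaugeAt C p (p - q) < Real.exp (2 * r) * (1 - gaugeAt C p (q - p)) := by
  rw [hilbertDist_lt_iff hC hp hq, Real.exp_neg, inv_lt_iff_one_lt_mul₀ (Real.exp_pos _)]
  have h := one_add_gaugeAt_mul hC hp hq
  have hg := gaugeAt_nonneg C p (p - q)
  have h2 := funkRatio_pos hC hq hp
  change _ ↔ _ < _ * funkRatio C p q
  change _ * funkRatio C q p = 1 at h
  rw [← mul_lt_mul_iff_left₀ h2 (b := 1 + _), h, mul_right_comm, mul_comm (Real.exp _)]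

theorem continuousOn_hilbertDist_segment (hC : IsConvexDomain C) (hp : p ∈ C) (hq : q ∈ C) :
    ContinuousOn (fun t : ℝ => hilbertDist C p (p + t • (q - p))) (Set.Icc 0 1) := by
  have hg := gaugeAt_nonneg C p (p - q)
  have hs := gaugeAt_sub_lt_one hC hp hq
  have hs0 := gaugeAt_nonneg C p (q - p)
  have h : ContinuousOn (fun t : ℝ => -(1 / 2) * (Real.log (1 - t * gaugeAt C p (q - p)) -
      Real.log (1 + t * gaugeAt C p (p - q)))) (Set.Icc 0 1) := by
    refine ContinuousOn.mul continuousOn_const (ContinuousOn.sub ?_ ?_)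
    · refine ContinuousOn.log (by fun_prop) fun t ht => ?_
      nlinarith [ht.1, ht.2]
    · refine ContinuousOn.log (by fun_prop) fun t ht => ?_
      nlinarith [ht.1, ht.2]
  refine h.congr fun t ht => ?_
  have hz : p + t • (q - p) ∈ C := hC.convex.add_smul_sub_mem hp hq ht
  have e : p - (p + t • (q - p)) = t • (p - q) := by module
  have h1 := one_add_gaugeAt_mul hC hp hz
  rw [e, gaugeAt_smul _ _ (p - q) ht.1] at h1
  change _ = _ * (_ - _)
  rw [hilbertDist_eq hC hp hz, funkRatio, add_sub_cancel_left, gaugeAt_smul _ _ _ ht.1,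
    funkRatio, e, eq_inv_of_mul_eq_one_right h1, Real.log_inv]
  ring

/-- The points of a Hilbert geometry are joined by geodesics. -/
theorem exists_hilbertDist_le (hC : IsConvexDomain C) (hp : p ∈ C) (hq : q ∈ C) {s t : ℝ}
    (hs : 0 ≤ s) (ht : 0 ≤ t) (hst : hilbertDist C p q ≤ s + t) :
    ∃ z ∈ C, hilbertDist C p z ≤ s ∧ hilbertDist C z q ≤ t := by
  rcases le_total (hilbertDist C p q) s with h | h
  · exact ⟨q, hq, h, by simpa [hilbertDist] using ht⟩
  have hcont := continuousOn_hilbertDist_segment hC hp hq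
  obtain ⟨u, hu, hus⟩ := intermediate_value_Icc zero_le_one hcont
    (show s ∈ Set.Icc _ _ by
      simp only [zero_smul, add_zero, one_smul, add_sub_cancel]
      exact ⟨by simpa [hilbertDist] using hs, h⟩)
  refine ⟨_, hC.convex.add_smul_sub_mem hp hq hu, hus.le, ?_⟩
  have := hilbertDist_add_le_of_mem_segment hC hp hq hu
  simp only at hus
  linarith

/-! ### The measure of Hilbert balls -/

theorem isOpen_hilbertBall (hC : IsConvexDomain C) (hx : x ∈ C) (r : ℝ) :
    IsOpen (hilbertBall C x r) := by
  have hg := continuous_gaugeAt hC hx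
  have e : hilbertBall C x r = C ∩ {y | 1 + gaugeAt C x (x - y) <
      Real.exp (2 * r) * (1 - gaugeAt C x (y - x))} :=
    Set.ext fun y => and_congr_right fun hy => hilbertDist_lt_iff_gaugeAt hC hx hy
  rw [e]
  exact hC.isOpen.inter (isOpen_lt (by fun_prop) (by fun_prop))

theorem finslerNorm_eq (hC : IsConvexDomain C) (hp : p ∈ C) (v : E n) :
    finslerNorm C p v = 1 / 2 * (gaugeAt C p v + gaugeAt C p (-v)) := by
  rcases eq_or_ne v 0 with rfl | hv
  · simp [finslerNorm]
  have key : ∀ {v : E n}, v ≠ 0 → 1 / ‖p - exitPoint C p v‖ = gaugeAt C p v / ‖v‖ := by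
    intro v hv
    have hg := gaugeAt_pos hC hp hv
    rw [exitPoint_eq hC hp hv, sub_add_cancel_left, norm_neg, norm_smul,
      Real.norm_of_nonneg (by positivity)]
    field_simp
  have hn := norm_pos_iff.mpr hv
  rw [finslerNorm, key hv, key (neg_ne_zero.mpr hv), norm_neg]
  field_simp
  ring

theorem finslerNorm_smul (hC : IsConvexDomain C) (hp : p ∈ C) (v : E n) {t : ℝ} (ht : 0 ≤ t) :
    finslerNorm C p (t • v) = t * finslerNorm C p v := by
  rw [finslerNorm_eq hC hp, finslerNorm_eq hC hp, ← smul_neg, gaugeAt_smul _ _ _ ht,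
    gaugeAt_smul _ _ _ ht]
  ring

theorem continuous_finslerNorm (hC : IsConvexDomain C) (hp : p ∈ C) :
    Continuous (finslerNorm C p) := by
  have hg := continuous_gaugeAt hC hp
  simp only [funext (finslerNorm_eq hC hp)]
  fun_prop

/-- The Finsler norms at two points at Hilbert distance less than `r` differ by a factor of at
most `exp (2 r)`. -/
theorem finslerNorm_le_mul (hC : IsConvexDomain C) (hp : p ∈ C) (hq : q ∈ C)
    (h : hilbertDist C p q < r) (v : E n) :
    finslerNorm C q v ≤ Real.exp (2 * r) * finslerNorm C p v := by
  have hA : Real.exp (-(2 * r)) < funkRatio C p q :=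
    ((hilbertDist_lt_iff hC hp hq).mp h).trans_le
      (mul_le_of_le_one_right (funkRatio_pos hC hp hq).le (funkRatio_le_one C q p))
  have key : ∀ v, gaugeAt C q v ≤ Real.exp (2 * r) * gaugeAt C p v := fun v => by
    have h1 : gaugeAt C q v * Real.exp (-(2 * r)) ≤ gaugeAt C p v :=
      (mul_le_mul_of_nonneg_left hA.le (gaugeAt_nonneg _ _ _)).trans (gaugeAt_mul_le hC hp hq v)
    rwa [Real.exp_neg, ← div_eq_mul_inv, div_le_iff₀' (Real.exp_pos _)] at h1
  rw [finslerNorm_eq hC hp, finslerNorm_eq hC hq]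
  linarith [key v, key (-v)]

/-- The volume of the unit ball of the Finsler norm at `p`. -/
def finslerUnitVolume (C : Set (E n)) (p : E n) : ℝ≥0∞ :=
  MeasureTheory.volume {v : E n | finslerNorm C p v < 1}

theorem volume_finslerNorm_lt (hC : IsConvexDomain C) (hp : p ∈ C) {t : ℝ} (ht : 0 < t) :
    MeasureTheory.volume {v : E n | finslerNorm C p v < t} =
      ENNReal.ofReal (t ^ n) * finslerUnitVolume C p := by
  have e : {v : E n | finslerNorm C p v < t} =
      (fun v => t⁻¹ • v) ⁻¹' {v : E n | finslerNorm C p v < 1} := by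
    ext v
    simp only [Set.mem_preimage, Set.mem_ofPred_eq]
    rw [finslerNorm_smul hC hp _ (inv_nonneg.mpr ht.le), inv_mul_lt_one₀ ht]
  rw [e, MeasureTheory.Measure.addHaar_preimage_smul _ (inv_ne_zero ht.ne'),
    finrank_euclideanSpace_fin, inv_pow, inv_inv, abs_of_pos (pow_pos ht n), finslerUnitVolume]

theorem finslerUnitVolume_pos (hC : IsConvexDomain C) (hp : p ∈ C) :
    0 < finslerUnitVolume C p :=
  (isOpen_lt (continuous_finslerNorm hC hp) continuous_const).measure_pos _
    ⟨0, by simp [finslerNorm]⟩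

theorem finslerUnitVolume_ne_top (hC : IsConvexDomain C) (hp : p ∈ C) :
    finslerUnitVolume C p ≠ ⊤ := by
  refine ne_top_of_le_ne_top
    ((hC.isBounded_preimage_add p).smul₀ (2 : ℝ)).measure_lt_top.ne
    (MeasureTheory.measure_mono fun v hv => ?_)
  have hv' : finslerNorm C p v < 1 := hv
  rw [finslerNorm_eq hC hp] at hv'
  refine ⟨(2 : ℝ)⁻¹ • v, ?_, smul_inv_smul₀ two_ne_zero v⟩
  change p + _ ∈ C
  rw [← gaugeAt_lt_one_iff hC hp, gaugeAt_smul _ _ _ (by norm_num)]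
  linarith [gaugeAt_nonneg C p (-v)]

theorem finslerUnitVolume_le_mul (hC : IsConvexDomain C) (hp : p ∈ C) (hq : q ∈ C)
    (h : hilbertDist C p q < r) :
    finslerUnitVolume C p ≤ ENNReal.ofReal (Real.exp (2 * r) ^ n) * finslerUnitVolume C q := by
  rw [← volume_finslerNorm_lt hC hq (Real.exp_pos _)]
  refine MeasureTheory.measure_mono fun v hv => (finslerNorm_le_mul hC hp hq h v).trans_lt ?_
  have hv' : finslerNorm C p v < 1 := hv
  exact mul_lt_of_lt_one_right (Real.exp_pos _) hv'

theorem hilbertMeasure_hilbertBall (hC : IsConvexDomain C) (hx : x ∈ C) (r : ℝ) :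
    hilbertMeasure C (hilbertBall C x r) =
      ∫⁻ y in hilbertBall C x r, hilbertDensity C y := by
  rw [hilbertMeasure, MeasureTheory.withDensity_apply',
    MeasureTheory.Measure.restrict_restrict (isOpen_hilbertBall hC hx r).measurableSet,
    Set.inter_eq_left.mpr fun y hy => hy.1]

/-- Hilbert balls of radius `r` have uniformly bounded measure: such a ball lies in a multiple of
the Finsler unit ball at its centre, and the density is comparable to its value there. -/
theorem exists_hilbertMeasure_hilbertBall_le (hC : IsConvexDomain C) (r : ℝ) :
    ∃ M : ℝ≥0∞, M ≠ 0 ∧ M ≠ ⊤ ∧ ∀ x ∈ C, hilbertMeasure C (hilbertBall C x r) ≤ M := by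
  set k := ENNReal.ofReal (Real.exp (2 * r) ^ n)
  set ω := MeasureTheory.volume (Metric.ball (0 : E n) 1)
  have hk0 : k ≠ 0 := (ENNReal.ofReal_pos.mpr (by positivity)).ne'
  have hk : k ≠ ⊤ := ENNReal.ofReal_ne_top
  have hω0 : ω ≠ 0 := (Metric.measure_ball_pos _ _ one_pos).ne'
  have hω : ω ≠ ⊤ := Metric.isBounded_ball.measure_lt_top.ne
  refine ⟨ω * k * k, mul_ne_zero (mul_ne_zero hω0 hk0) hk0,
    ENNReal.mul_ne_top (ENNReal.mul_ne_top hω hk) hk, fun x hx => ?_⟩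
  have hV0 := (finslerUnitVolume_pos hC hx).ne'
  have hV := finslerUnitVolume_ne_top hC hx
  have hdens : ∀ y ∈ hilbertBall C x r,
      hilbertDensity C y ≤ ω * k / finslerUnitVolume C x := fun y hy => by
    have hW0 := (finslerUnitVolume_pos hC hy.1).ne'
    have hW := finslerUnitVolume_ne_top hC hy.1
    rw [ENNReal.le_div_iff_mul_le (Or.inl hV0) (Or.inl hV)]
    calc ω / finslerUnitVolume C y * finslerUnitVolume C x
        ≤ ω / finslerUnitVolume C y * (k * finslerUnitVolume C y) := by
          gcongr; exact finslerUnitVolume_le_mul hC hx hy.1 hy.2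
      _ = ω / finslerUnitVolume C y * finslerUnitVolume C y * k := by ring
      _ = ω * k := by rw [ENNReal.div_mul_cancel hW0 hW]
  have hsub : hilbertBall C x r ⊆
      (fun y => -x + y) ⁻¹' {v | finslerNorm C x v < Real.exp (2 * r)} := fun y hy => by
    have h := (hilbertDist_lt_iff_gaugeAt hC hx hy.1).mp hy.2
    have h1 := gaugeAt_sub_lt_one hC hx hy.1
    have h2 := gaugeAt_nonneg C x (y - x)
    have h3 := gaugeAt_nonneg C x (x - y)
    change finslerNorm C x (-x + y) < _
    rw [neg_add_eq_sub, finslerNorm_eq hC hx, neg_sub]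
    nlinarith [Real.exp_pos (2 * r)]
  rw [hilbertMeasure_hilbertBall hC hx]
  calc ∫⁻ y in hilbertBall C x r, hilbertDensity C y
      ≤ ∫⁻ _ in hilbertBall C x r, ω * k / finslerUnitVolume C x :=
        MeasureTheory.setLIntegral_mono' (isOpen_hilbertBall hC hx r).measurableSet hdens
    _ = ω * k / finslerUnitVolume C x * MeasureTheory.volume (hilbertBall C x r) :=
        MeasureTheory.setLIntegral_const _ _
    _ ≤ ω * k / finslerUnitVolume C x * (k * finslerUnitVolume C x) := by
        gcongr
        refine (MeasureTheory.measure_mono hsub).trans_eq ?_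
        rw [MeasureTheory.measure_preimage_add, volume_finslerNorm_lt hC hx (Real.exp_pos _)]
    _ = ω * k / finslerUnitVolume C x * finslerUnitVolume C x * k := by ring
    _ = ω * k * k := by rw [ENNReal.div_mul_cancel hV0 hV]

/-- Hilbert balls of radius `r` have measure bounded away from zero: such a ball contains a
multiple of the Finsler unit ball at its centre, and the density is comparable to its value
there. -/
theorem exists_le_hilbertMeasure_hilbertBall (hC : IsConvexDomain C) (hr : 0 < r) :
    ∃ m : ℝ≥0∞, m ≠ 0 ∧ m ≠ ⊤ ∧ ∀ x ∈ C, m ≤ hilbertMeasure C (hilbertBall C x r) := by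
  set K := Real.exp (2 * r) with hK
  have hK1 : 1 < K := Real.one_lt_exp_iff.mpr (by linarith)
  -- the solution of `1 + 2 δ = K (1 - 2 δ)`
  set δ := (K - 1) / (2 * (K + 1)) with hδ
  have hδ0 : 0 < δ := div_pos (by linarith) (by linarith)
  have hδK : 1 + 2 * δ = K * (1 - 2 * δ) := by
    rw [hδ]; field_simp; ring
  set k := ENNReal.ofReal (K ^ n)
  set l := ENNReal.ofReal (δ ^ n)
  set ω := MeasureTheory.volume (Metric.ball (0 : E n) 1)
  have hk0 : k ≠ 0 := (ENNReal.ofReal_pos.mpr (by positivity)).ne'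
  have hk : k ≠ ⊤ := ENNReal.ofReal_ne_top
  have hl0 : l ≠ 0 := (ENNReal.ofReal_pos.mpr (by positivity)).ne'
  have hl : l ≠ ⊤ := ENNReal.ofReal_ne_top
  have hω0 : ω ≠ 0 := (Metric.measure_ball_pos _ _ one_pos).ne'
  have hω : ω ≠ ⊤ := Metric.isBounded_ball.measure_lt_top.ne
  refine ⟨ω / k * l, mul_ne_zero (ENNReal.div_ne_zero.mpr ⟨hω0, hk⟩) hl0,
    ENNReal.mul_ne_top (ENNReal.div_ne_top hω hk0) hl, fun x hx => ?_⟩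
  have hV0 := (finslerUnitVolume_pos hC hx).ne'
  have hV := finslerUnitVolume_ne_top hC hx
  have hdens : ∀ y ∈ hilbertBall C x r,
      ω / k / finslerUnitVolume C x ≤ hilbertDensity C y := fun y hy => by
    have h : finslerUnitVolume C y ≤ k * finslerUnitVolume C x :=
      finslerUnitVolume_le_mul hC hy.1 hx (by rw [hilbertDist_comm]; exact hy.2)
    rw [div_eq_mul_inv, div_eq_mul_inv, mul_assoc, ← ENNReal.mul_inv (Or.inl hk0) (Or.inl hk)]
    exact ENNReal.div_le_div_left h ω
  have hsub : (fun y => -x + y) ⁻¹' {v | finslerNorm C x v < δ} ⊆ hilbertBall C x r :=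
    fun y hy => by
    have hy' : finslerNorm C x (-x + y) < δ := hy
    rw [neg_add_eq_sub, finslerNorm_eq hC hx, neg_sub] at hy'
    have h2 := gaugeAt_nonneg C x (y - x)
    have h3 := gaugeAt_nonneg C x (x - y)
    have hyC : y ∈ C := by
      have h4 : gaugeAt C x (y - x) < 1 := by nlinarith
      rwa [gaugeAt_lt_one_iff hC hx, add_sub_cancel] at h4
    refine ⟨hyC, (hilbertDist_lt_iff_gaugeAt hC hx hyC).mpr ?_⟩
    rw [← hK]
    nlinarith
  rw [hilbertMeasure_hilbertBall hC hx]
  calc ω / k * l = ω / k / finslerUnitVolume C x * finslerUnitVolume C x * l := by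
        rw [ENNReal.div_mul_cancel hV0 hV]
    _ = ω / k / finslerUnitVolume C x * (l * finslerUnitVolume C x) := by ring
    _ ≤ ω / k / finslerUnitVolume C x * MeasureTheory.volume (hilbertBall C x r) := by
        gcongr
        refine Eq.trans_le ?_ (MeasureTheory.measure_mono hsub)
        rw [MeasureTheory.measure_preimage_add, volume_finslerNorm_lt hC hx hδ0]
    _ = ∫⁻ _ in hilbertBall C x r, ω / k / finslerUnitVolume C x :=
        (MeasureTheory.setLIntegral_const _ _).symm
    _ ≤ ∫⁻ y in hilbertBall C x r, hilbertDensity C y :=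
        MeasureTheory.setLIntegral_mono' (isOpen_hilbertBall hC hx r).measurableSet hdens

/-! ### The graph distance of a discretisation -/

theorem IsDiscretisation.exists_hilbertDist_lt (h𝒢 : IsDiscretisation C 𝒢 ε ρ) {x : E n}
    (hx : x ∈ C) : ∃ ξ : 𝒢, hilbertDist C ξ x < ρ := by
  rw [h𝒢.covering] at hx
  obtain ⟨ξ, hξ, h⟩ := Set.mem_iUnion₂.mp hx
  exact ⟨⟨ξ, hξ⟩, h.2⟩

theorem hilbertDist_le_of_walk (hC : IsConvexDomain C) (h𝒢 : IsDiscretisation C 𝒢 ε ρ) {ξ η : 𝒢}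
    (w : (discretisationGraph C 𝒢 ρ).Walk ξ η) :
    hilbertDist C ξ η ≤ 3 * ρ * w.length := by
  induction w with
  | nil => simp [hilbertDist]
  | @cons a b c h w ih =>
    have := hilbertDist_triangle hC (h𝒢.subset a.2) (h𝒢.subset b.2) (h𝒢.subset c.2)
    have h2 : hilbertDist C a b < 3 * ρ := h.2
    rw [SimpleGraph.Walk.length_cons]
    push_cast
    linarith

/-- A chain of points of `𝒢` that follows the segment from `x` to `η` in steps of length `ρ`. -/
theorem exists_walk_length_le (hC : IsConvexDomain C) (h𝒢 : IsDiscretisation C 𝒢 ε ρ) (N : ℕ)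
    (ξ η : 𝒢) {x : E n} (hx : x ∈ C) (hξ : hilbertDist C ξ x < ρ)
    (hN : hilbertDist C x η ≤ N * ρ) :
    ∃ w : (discretisationGraph C 𝒢 ρ).Walk ξ η, w.length ≤ N + 1 := by
  induction N generalizing ξ x with
  | zero =>
    by_cases h : ξ = η
    · subst h
      exact ⟨.nil, by simp⟩
    · have := hilbertDist_triangle hC (h𝒢.subset ξ.2) hx (h𝒢.subset η.2)
      have hρ := h𝒢.ρ_pos
      have hadj : (discretisationGraph C 𝒢 ρ).Adj ξ η :=
        ⟨h, by push_cast at hN; linarith⟩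
      exact ⟨hadj.toWalk, by simp⟩
  | succ N ih =>
    have hρ := h𝒢.ρ_pos
    obtain ⟨z, hz, h1, h2⟩ := exists_hilbertDist_le hC hx (h𝒢.subset η.2) hρ.le
      (by positivity : 0 ≤ N * ρ) (by push_cast at hN; linarith)
    obtain ⟨ζ, hζ⟩ := h𝒢.exists_hilbertDist_lt hz
    obtain ⟨w, hw⟩ := ih ζ hz hζ h2
    by_cases h : ξ = ζ
    · subst h
      exact ⟨w, by omega⟩
    · have t1 := hilbertDist_triangle hC (h𝒢.subset ξ.2) hx hz
      have t2 := hilbertDist_triangle hC (h𝒢.subset ξ.2) hz (h𝒢.subset ζ.2)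
      rw [hilbertDist_comm C ζ z] at hζ
      have hadj : (discretisationGraph C 𝒢 ρ).Adj ξ ζ := ⟨h, by linarith⟩
      exact ⟨.cons hadj w, by simpa using hw⟩

theorem reachable_and_dist_le (hC : IsConvexDomain C) (h𝒢 : IsDiscretisation C 𝒢 ε ρ)
    (ξ η : 𝒢) : (discretisationGraph C 𝒢 ρ).Reachable ξ η ∧
      ((discretisationGraph C 𝒢 ρ).dist ξ η : ℝ) ≤ hilbertDist C ξ η / ρ + 2 := by
  have hρ := h𝒢.ρ_pos
  have hd : 0 ≤ hilbertDist C ξ η / ρ :=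
    div_nonneg (hilbertDist_nonneg hC (h𝒢.subset ξ.2) (h𝒢.subset η.2)) hρ.le
  obtain ⟨w, hw⟩ := exists_walk_length_le hC h𝒢 ⌈hilbertDist C ξ η / ρ⌉₊ ξ η (h𝒢.subset ξ.2)
    (by simpa [hilbertDist] using hρ) ((div_le_iff₀ hρ).mp (Nat.le_ceil _))
  refine ⟨w.reachable, ?_⟩
  have h1 : ((discretisationGraph C 𝒢 ρ).dist ξ η : ℝ) ≤ ⌈hilbertDist C ξ η / ρ⌉₊ + 1 := by
    exact_mod_cast (SimpleGraph.dist_le w).trans hw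
  linarith [Nat.ceil_lt_add_one hd]

/-! ### Comparison of the volume functions -/

/-- Packing: the balls of radius `ε / 2` around the points of `𝒢` are disjoint. -/
theorem exists_graphVolume_le (hC : IsConvexDomain C) (h𝒢 : IsDiscretisation C 𝒢 ε ρ) (D : ℝ) :
    ∃ K : ℝ≥0∞, K ≠ 0 ∧ K ≠ ⊤ ∧ ∀ (ξ : 𝒢) (x : C), hilbertDist C ξ x ≤ D → ∀ R : ℝ,
      graphVolume (discretisationGraph C 𝒢 ρ) ξ R ≤
        K * hilbertVolume C x (3 * ρ * R + (D + ε)) := by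
  have hε := h𝒢.ε_pos
  have hρ := h𝒢.ρ_pos
  obtain ⟨m, hm0, hm, hball⟩ := exists_le_hilbertMeasure_hilbertBall hC (half_pos hε)
  refine ⟨m⁻¹, ENNReal.inv_ne_zero.mpr hm, ENNReal.inv_ne_top.mpr hm0, fun ξ x hξx R => ?_⟩
  set S := {η : 𝒢 | (discretisationGraph C 𝒢 ρ).Reachable ξ η ∧
    ((discretisationGraph C 𝒢 ρ).dist ξ η : ℝ) ≤ R} with hS
  have hdisj : Pairwise (Function.onFun Disjoint
      fun η : S => hilbertBall C ((η : 𝒢) : E n) (ε / 2)) := by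
    intro a b hab
    refine Set.disjoint_left.mpr fun y hya hyb => ?_
    have h1 := h𝒢.separated (a : 𝒢) (a : 𝒢).2 (b : 𝒢) (b : 𝒢).2
      fun h => hab (Subtype.ext (Subtype.ext h))
    have h2 := hilbertDist_triangle hC (h𝒢.subset (a : 𝒢).2) hya.1 (h𝒢.subset (b : 𝒢).2)
    have h3 := hya.2
    have h4 := hyb.2
    rw [hilbertDist_comm] at h4
    linarith
  have hsub : (⋃ η : S, hilbertBall C ((η : 𝒢) : E n) (ε / 2)) ⊆
      hilbertBall C x (3 * ρ * R + (D + ε)) := by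
    refine Set.iUnion_subset fun η y hy => ⟨hy.1, ?_⟩
    obtain ⟨w, hw⟩ := η.2.1.exists_walk_length_eq_dist
    have h1 := hilbertDist_le_of_walk hC h𝒢 w
    rw [hw] at h1
    have h2 := mul_le_mul_of_nonneg_left η.2.2 (by positivity : 0 ≤ 3 * ρ)
    have h3 := hilbertDist_triangle hC x.2 (h𝒢.subset ξ.2) hy.1
    have h4 := hilbertDist_triangle hC (h𝒢.subset ξ.2) (h𝒢.subset (η : 𝒢).2) hy.1
    have h5 := hy.2
    rw [hilbertDist_comm] at hξx
    linarith
  have hcount : graphVolume (discretisationGraph C 𝒢 ρ) ξ R * m ≤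
      hilbertVolume C x (3 * ρ * R + (D + ε)) := by
    calc graphVolume (discretisationGraph C 𝒢 ρ) ξ R * m = ∑' _ : S, m :=
          (ENNReal.tsum_set_const S m).symm
      _ ≤ ∑' η : S, hilbertMeasure C (hilbertBall C ((η : 𝒢) : E n) (ε / 2)) :=
          ENNReal.tsum_le_tsum fun η => hball _ (h𝒢.subset (η : 𝒢).2)
      _ ≤ hilbertMeasure C (⋃ η : S, hilbertBall C ((η : 𝒢) : E n) (ε / 2)) :=
          MeasureTheory.tsum_meas_le_meas_iUnion_of_disjoint _
            (fun η => (isOpen_hilbertBall hC (h𝒢.subset (η : 𝒢).2) _).measurableSet) hdisj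
      _ ≤ _ := MeasureTheory.measure_mono hsub
  rw [mul_comm, ← div_eq_mul_inv, ENNReal.le_div_iff_mul_le (Or.inl hm0) (Or.inl hm)]
  exact hcount

/-- Covering: the balls of radius `ρ` around the points of `𝒢` cover `C`. -/
theorem exists_hilbertVolume_le (hC : IsConvexDomain C) (h𝒢 : IsDiscretisation C 𝒢 ε ρ) (D : ℝ) :
    ∃ K : ℝ≥0∞, K ≠ 0 ∧ K ≠ ⊤ ∧ ∀ (ξ : 𝒢) (x : C), hilbertDist C ξ x ≤ D → ∀ R : ℝ,
      hilbertVolume C x R ≤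
        K * graphVolume (discretisationGraph C 𝒢 ρ) ξ (ρ⁻¹ * R + (D / ρ + 3)) := by
  have hρ := h𝒢.ρ_pos
  obtain ⟨M, hM0, hM, hball⟩ := exists_hilbertMeasure_hilbertBall_le hC ρ
  refine ⟨M, hM0, hM, fun ξ x hξx R => ?_⟩
  set S := {η : 𝒢 | (discretisationGraph C 𝒢 ρ).Reachable ξ η ∧
    ((discretisationGraph C 𝒢 ρ).dist ξ η : ℝ) ≤ ρ⁻¹ * R + (D / ρ + 3)} with hS
  have hcard : graphVolume (discretisationGraph C 𝒢 ρ) ξ (ρ⁻¹ * R + (D / ρ + 3)) =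
    ((S.encard : ℕ∞) : ℝ≥0∞) := rfl
  rcases S.finite_or_infinite with hfin | hinf
  swap
  · rw [hcard, hinf.encard_eq, ENat.toENNReal_top, ENNReal.mul_top hM0]
    exact le_top
  have hsub : hilbertBall C x R ⊆ ⋃ η ∈ S, hilbertBall C ((η : 𝒢) : E n) ρ := by
    intro y hy
    obtain ⟨η, hη⟩ := h𝒢.exists_hilbertDist_lt hy.1
    obtain ⟨hr, hd⟩ := reachable_and_dist_le hC h𝒢 ξ η
    refine Set.mem_iUnion₂.mpr ⟨η, ⟨hr, hd.trans ?_⟩, hy.1, hη⟩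
    have h1 := hilbertDist_triangle hC (h𝒢.subset ξ.2) x.2 (h𝒢.subset η.2)
    have h2 := hilbertDist_triangle hC x.2 hy.1 (h𝒢.subset η.2)
    have h3 := hy.2
    rw [hilbertDist_comm] at hη
    have h4 : hilbertDist C ξ η / ρ ≤ (R + D + ρ) / ρ := by gcongr; linarith
    have h5 : (R + D + ρ) / ρ = ρ⁻¹ * R + D / ρ + 1 := by field_simp
    linarith
  calc hilbertVolume C x R ≤ ∑' η : S, hilbertMeasure C (hilbertBall C ((η : 𝒢) : E n) ρ) :=
        (MeasureTheory.measure_mono hsub).trans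
          (MeasureTheory.measure_biUnion_le _ hfin.countable _)
    _ ≤ ∑' _ : S, M := ENNReal.tsum_le_tsum fun η => hball _ (h𝒢.subset (η : 𝒢).2)
    _ = M * graphVolume (discretisationGraph C 𝒢 ρ) ξ (ρ⁻¹ * R + (D / ρ + 3)) := by
        rw [ENNReal.tsum_set_const, hcard, mul_comm]

theorem hilbertVolume_mono (C : Set (E n)) (x : C) : Monotone (hilbertVolume C x) :=
  fun _ _ h => MeasureTheory.measure_mono fun _ hy => ⟨hy.1, hy.2.trans_le h⟩

theorem graphVolume_mono {V : Type*} (G : SimpleGraph V) (ξ : V) : Monotone (graphVolume G ξ) :=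
  fun _ _ h => ENat.toENNReal_mono (Set.encard_le_encard fun _ hη => ⟨hη.1, hη.2.trans h⟩)

theorem one_le_graphVolume {V : Type*} (G : SimpleGraph V) (ξ : V) {R : ℝ} (hR : 0 ≤ R) :
    1 ≤ graphVolume G ξ R := by
  rw [graphVolume, ← ENat.toENNReal_one]
  exact ENat.toENNReal_mono (Set.one_le_encard_iff_nonempty.mpr ⟨ξ, .refl ξ, by simpa using hR⟩)

/-! ### Transfer of growth types -/

section Transfer

variable {X Y : Type*} {f : X → ℝ → ℝ≥0∞} {g : Y → ℝ → ℝ≥0∞} {K : ℝ≥0∞} {α β : ℝ}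

theorem PolynomialGrowth.of_le (hg : PolynomialGrowth g) (hmono : ∀ y, Monotone (g y))
    (hK : K ≠ ⊤) (hα : 0 < α)
    (h : ∀ x, ∃ y, ∀ R, f x R ≤ K * g y (α * R + β)) : PolynomialGrowth f := by
  obtain ⟨a, d, ha⟩ := hg
  refine ⟨K.toReal * (|a| * (α + |β| + 1) ^ d), d, fun x R hR => ?_⟩
  obtain ⟨y, hy⟩ := h x
  have hβ := abs_nonneg β
  have h1 : α * R + β ≤ (α + |β| + 1) * R := by nlinarith [le_abs_self β]
  have h2 : 1 ≤ (α + |β| + 1) * R := by nlinarith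
  calc f x R ≤ K * g y ((α + |β| + 1) * R) :=
        (hy R).trans (mul_le_mul_right (hmono y h1) K)
    _ ≤ K * ENNReal.ofReal (a * ((α + |β| + 1) * R) ^ d) := by gcongr; exact ha y _ h2
    _ ≤ K * ENNReal.ofReal (|a| * ((α + |β| + 1) * R) ^ d) := by
        gcongr; exact le_abs_self a
    _ = ENNReal.ofReal (K.toReal * (|a| * (α + |β| + 1) ^ d) * R ^ d) := by
        conv_lhs => rw [← ENNReal.ofReal_toReal hK]
        rw [← ENNReal.ofReal_mul ENNReal.toReal_nonneg, mul_pow]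
        ring_nf

/-- The lower bound on `g` is needed for radii below `α + β`, where `f` says nothing. -/
theorem ExponentialGrowth.of_le (hf : ExponentialGrowth f) {b : ℝ} (hb : 0 < b)
    (hgb : ∀ y R, 1 ≤ R → ENNReal.ofReal b ≤ g y R) (hK0 : K ≠ 0) (hK : K ≠ ⊤) (hα : 0 < α)
    (h : ∀ y, ∃ x, ∀ R, f x R ≤ K * g y (α * R + β)) : ExponentialGrowth g := by
  obtain ⟨a, c, ha, hc, hac⟩ := hf
  have hk : 0 < K.toReal := ENNReal.toReal_pos hK0 hK
  set c' := c / α with hc'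
  have hc'0 : 0 < c' := div_pos hc hα
  refine ⟨min (a / K.toReal * Real.exp (-(c' * β))) (b * Real.exp (-(c' * (α + β)))), c',
    by positivity, hc'0, fun y S hS => ?_⟩
  obtain ⟨x, hx⟩ := h y
  rcases le_total (α + β) S with hle | hle
  · have hR : 1 ≤ (S - β) / α := by rw [le_div_iff₀ hα]; linarith
    have h1 := (hac x _ hR).trans (hx ((S - β) / α))
    rw [mul_div_cancel₀ _ hα.ne', sub_add_cancel] at h1
    have h2 : ENNReal.ofReal (a / K.toReal * Real.exp (c * ((S - β) / α))) ≤ g y S := by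
      rw [div_mul_eq_mul_div, ENNReal.ofReal_div_of_pos hk, ENNReal.ofReal_toReal hK]
      exact ENNReal.div_le_of_le_mul' h1
    refine le_trans (ENNReal.ofReal_le_ofReal ?_) h2
    have e : c * ((S - β) / α) = -(c' * β) + c' * S := by rw [hc']; field_simp; ring
    rw [e, Real.exp_add, ← mul_assoc]
    gcongr
    exact min_le_left _ _
  · refine le_trans (ENNReal.ofReal_le_ofReal ?_) (hgb y S hS)
    calc _ ≤ b * Real.exp (-(c' * (α + β))) * Real.exp (c' * S) := by
          gcongr; exact min_le_right _ _
      _ = b * Real.exp (c' * (S - (α + β))) := by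
          rw [mul_assoc, ← Real.exp_add]; ring_nf
      _ ≤ b * 1 := by
          gcongr
          exact Real.exp_le_one_iff.mpr (mul_nonpos_of_nonneg_of_nonpos hc'0.le (by linarith))
      _ = b := mul_one b

end Transfer

/-- The growth types of families of graph and Hilbert volume functions agree, provided that each
member of either family is centred near the centre of a member of the other one. -/
theorem growth_iff (hC : IsConvexDomain C) (h𝒢 : IsDiscretisation C 𝒢 ε ρ) {X Y : Type*}
    (ξ : X → 𝒢) (x : Y → C) (D : ℝ)
    (hX : ∀ i, ∃ j, hilbertDist C (ξ i) (x j) ≤ D)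
    (hY : ∀ j, ∃ i, hilbertDist C (ξ i) (x j) ≤ D) :
    (PolynomialGrowth (fun i => graphVolume (discretisationGraph C 𝒢 ρ) (ξ i)) ↔
      PolynomialGrowth (fun j => hilbertVolume C (x j))) ∧
    (ExponentialGrowth (fun i => graphVolume (discretisationGraph C 𝒢 ρ) (ξ i)) ↔
      ExponentialGrowth (fun j => hilbertVolume C (x j))) := by
  have hρ := h𝒢.ρ_pos
  obtain ⟨K, hK0, hK, hpack⟩ := exists_graphVolume_le hC h𝒢 D
  obtain ⟨L, hL0, hL, hcov⟩ := exists_hilbertVolume_le hC h𝒢 D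
  obtain ⟨m, hm0, hm, hball⟩ := exists_le_hilbertMeasure_hilbertBall hC one_pos
  refine ⟨⟨fun h => h.of_le (β := D / ρ + 3) (fun i => graphVolume_mono _ _) hL (inv_pos.mpr hρ)
        fun j => ?_,
      fun h => h.of_le (β := D + ε) (fun j => hilbertVolume_mono _ _) hK
        (by positivity : 0 < 3 * ρ) fun i => ?_⟩,
    ⟨fun h => h.of_le (β := D + ε) (ENNReal.toReal_pos hm0 hm) (fun j R hR => ?_) hK0 hK
        (by positivity : 0 < 3 * ρ) fun j => ?_,
      fun h => h.of_le (β := D / ρ + 3) one_pos (fun i R hR => ?_) hL0 hL (inv_pos.mpr hρ)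
        fun i => ?_⟩⟩
  · obtain ⟨i, hi⟩ := hY j
    exact ⟨i, hcov _ _ hi⟩
  · obtain ⟨j, hj⟩ := hX i
    exact ⟨j, hpack _ _ hj⟩
  · rw [ENNReal.ofReal_toReal hm]
    exact (hball _ (x j).2).trans (hilbertVolume_mono C (x j) hR)
  · obtain ⟨i, hi⟩ := hY j
    exact ⟨i, hpack _ _ hi⟩
  · rw [ENNReal.ofReal_one]
    exact one_le_graphVolume _ _ (by linarith)
  · obtain ⟨j, hj⟩ := hX i
    exact ⟨j, hcov _ _ hj⟩

theorem polynomialGrowthAt_iff (v : ℝ → ℝ≥0∞) :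
    PolynomialGrowthAt v ↔ PolynomialGrowth (fun _ : Unit => v) := by
  simp [PolynomialGrowthAt, PolynomialGrowth]

theorem exponentialGrowthAt_iff (v : ℝ → ℝ≥0∞) :
    ExponentialGrowthAt v ↔ ExponentialGrowth (fun _ : Unit => v) := by
  simp [ExponentialGrowthAt, ExponentialGrowth]

end HilbertGeometry

end

theorem mainTheorem10 {n : ℕ} (C : Set (HilbertGeometry.E n))
    (hC : HilbertGeometry.IsConvexDomain C) (𝒢 : Set (HilbertGeometry.E n)) (ε ρ : ℝ)
    (h𝒢 : HilbertGeometry.IsDiscretisation C 𝒢 ε ρ) :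
    ((HilbertGeometry.PolynomialGrowth
          (HilbertGeometry.graphVolume (HilbertGeometry.discretisationGraph C 𝒢 ρ)) ↔
        HilbertGeometry.PolynomialGrowth (HilbertGeometry.hilbertVolume C)) ∧
      (HilbertGeometry.ExponentialGrowth
          (HilbertGeometry.graphVolume (HilbertGeometry.discretisationGraph C 𝒢 ρ)) ↔
        HilbertGeometry.ExponentialGrowth (HilbertGeometry.hilbertVolume C))) ∧
    ∀ (ξ : 𝒢) (x : C),
      (HilbertGeometry.PolynomialGrowthAt
          (HilbertGeometry.graphVolume (HilbertGeometry.discretisationGraph C 𝒢 ρ) ξ) ↔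
        HilbertGeometry.PolynomialGrowthAt (HilbertGeometry.hilbertVolume C x)) ∧
      (HilbertGeometry.ExponentialGrowthAt
          (HilbertGeometry.graphVolume (HilbertGeometry.discretisationGraph C 𝒢 ρ) ξ) ↔
        HilbertGeometry.ExponentialGrowthAt (HilbertGeometry.hilbertVolume C x)) := by
  refine ⟨HilbertGeometry.growth_iff hC h𝒢 id id ρ (fun ξ => ?_) fun x => ?_, fun ξ x => ?_⟩
  · exact ⟨⟨ξ, h𝒢.subset ξ.2⟩, by simpa [HilbertGeometry.hilbertDist] using h𝒢.ρ_pos.le⟩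
  · obtain ⟨ξ, hξ⟩ := h𝒢.exists_hilbertDist_lt x.2
    exact ⟨ξ, hξ.le⟩
  · simp only [HilbertGeometry.polynomialGrowthAt_iff, HilbertGeometry.exponentialGrowthAt_iff]
    exact HilbertGeometry.growth_iff hC h𝒢 (fun _ : Unit => ξ) (fun _ : Unit => x)
      (HilbertGeometry.hilbertDist C ξ x) (fun _ => ⟨(), le_rfl⟩) fun _ => ⟨(), le_rfl⟩
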